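/- Let $(M,g)$ be a smooth connected finite-dimensional Riemannian manifold without boundary (for instance, the universal cover of a complete Riemannian manifold with sectional curvatures between $-1$ and $0$), with Riemannian distance $d$ and $\langle\cdot,\cdot\rangle=g$. Write $D_r,D_s,D_t$ for covariant differentiation along curves with respect to the Levi-Civita connection. Let $\gamma,\eta:[0,1]\to M$ be disjoint unit speed geodesic segments and set $\phi(r,s)=d(\gamma(s),\eta(r))$ for $(r,s)\in[0,1]^2$. Fix $(r_0,s_0)\in[0,1]^2$ and put $\rho_0=\phi(r_0,s_0)>0$. Let $\Psi:[0,1]\times[0,1]\times[0,\rho_0]\to M$ be a smooth variation through geodesics such that, for all $(r,s)$, the curve $t\mapsto\Psi(r,s,t)$ is a geodesic from $\Psi(r,s,0)=\eta(r)$ to $\Psi(r,s,\rho_0)=\gamma(s)$ with constant speed $d(\gamma(s),\eta(r))/\rho_0$. Put $$\dot\sigma_0=\partial_t\Psi(r_0,s_0,0),\quad V_0=\partial_r\Psi(r_0,s_0,0),\quad W_t=\partial_s\Psi(r_0,s_0,t),\quad D_tW_0=D_tW_t|_{t=0},$$ and for a vector $X$ tangent to $M$ at $\eta(r_0)$ let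 $X^\perp=X-\langle X,\dot\sigma_0\rangle\dot\sigma_0$ be its component normal to $\dot\sigma_0$; $D_tW_0^\perp$ means $(D_tW_0)^\perp$. Then $\phi$ is $C^\infty$ on $[0,1]^2$ (with one-sided derivatives at the boundary), it satisfies the second variation formula $$\partial^2_{rs}\phi(r_0,s_0)=-\langle V_0^\perp,D_tW_0^\perp\rangle,$$ and it satisfies the "third variation" formula $$\partial^3_{rss}\phi(r_0,s_0)=-\big\langle V_0^\perp,(D_s^2\partial_t\Psi)^\perp|_{(r_0,s_0,0)}\big\rangle+2\langle D_tW_0^\perp,V_0^\perp\rangle\langle D_tW_0,\dot\sigma_0\rangle+|D_tW_0^\perp|_g^2\,\langle V_0,\dot\sigma_0\rangle.$$ -/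

import Mathlib

open Set Bundle Manifold
open scoped ContDiff

noncomputable section

namespace GeodVar

variable {E : Type*} [NormedAddCommGroup E] [NormedSpace ℝ E] [FiniteDimensional ℝ E]
  {M : Type*} [MetricSpace M] [ChartedSpace E M] [IsManifold 𝓘(ℝ, E) ∞ M]
  [RiemannianBundle (fun x : M => TangentSpace 𝓘(ℝ, E) x)]

/-! ### The Levi-Civita connection in charts, and covariant differentiation along curves

For `p : M` and `v` a tangent vector at `p`, `FiberBundle.extend E v` is the local coordinate
vector field which, in the preferred chart at `p`, has the constant components of `v`.
Such fields commute pairwise near `p`. -/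

/-- The metric coefficient `g(V, W)` near `p`, for the coordinate fields `V`, `W` with values
`v`, `w` at `p`. -/
def metricCoeff (p : M) (v w : TangentSpace 𝓘(ℝ, E) p) : M → ℝ := fun x =>
  inner ℝ (FiberBundle.extend E v x : TangentSpace 𝓘(ℝ, E) x)
    (FiberBundle.extend E w x : TangentSpace 𝓘(ℝ, E) x)

/-- Christoffel symbols of the first kind at `p`, in the preferred chart at `p`:
`(∂_u g(v, w) + ∂_v g(u, w) - ∂_w g(u, v)) / 2`. -/
def christoffelFirst (p : M) (u v w : TangentSpace 𝓘(ℝ, E) p) : ℝ :=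
  (mvfderiv 𝓘(ℝ, E) (metricCoeff p v w) p u + mvfderiv 𝓘(ℝ, E) (metricCoeff p u w) p v
    - mvfderiv 𝓘(ℝ, E) (metricCoeff p u v) p w) / 2

instance finiteDimensional_tangentSpace (p : M) :
    FiniteDimensional ℝ (TangentSpace 𝓘(ℝ, E) p) :=
  inferInstanceAs (FiniteDimensional ℝ E)

/-- Christoffel symbols of the second kind at `p`, in the preferred chart at `p`: the tangent
vector `Γ(u, v)` at `p` with `⟨Γ(u, v), w⟩ = christoffelFirst p u v w`, that is `∇_u V` at `p` for
the Levi-Civita connection `∇` and the coordinate field `V` with `V p = v`. It is written out in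
an orthonormal basis of the tangent space (the choice of the basis is immaterial, since
`christoffelFirst` is linear in `w`). -/
def christoffel (p : M) (u v : TangentSpace 𝓘(ℝ, E) p) : TangentSpace 𝓘(ℝ, E) p :=
  ∑ i, christoffelFirst p u v (stdOrthonormalBasis ℝ (TangentSpace 𝓘(ℝ, E) p) i) •
    stdOrthonormalBasis ℝ (TangentSpace 𝓘(ℝ, E) p) i

/-- The velocity at time `t` of a curve `c` which is considered on `J` only (one-sided at an end
point of an interval `J`). -/
def velocity (E : Type*) [NormedAddCommGroup E] [NormedSpace ℝ E]
    {M : Type*} [TopologicalSpace M] [ChartedSpace E M]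
    (J : Set ℝ) (c : ℝ → M) (t : ℝ) : TangentSpace 𝓘(ℝ, E) (c t) :=
  mfderivWithin 𝓘(ℝ, ℝ) 𝓘(ℝ, E) c J t (1 : ℝ)

/-- The covariant derivative `D_t X` at time `t` of a vector field `X` along a curve `c`, both
considered on `J` only, for the Levi-Civita connection. In the preferred chart at `c t` this is the
classical formula `(D_t X)^k = (X^k)' + Γ^k_{ij} (c^i)' X^j`; the differential of that chart at
`c t` is the identity, so that a vector of components is a tangent vector at `c t`. -/
def covDerivAlong (J : Set ℝ) (c : ℝ → M) (X : ∀ t, TangentSpace 𝓘(ℝ, E) (c t)) (t : ℝ) :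
    TangentSpace 𝓘(ℝ, E) (c t) :=
  let Y : ℝ → E := fun τ => (trivializationAt E (TangentSpace 𝓘(ℝ, E)) (c t)
    (⟨c τ, X τ⟩ : TangentBundle 𝓘(ℝ, E) M)).2
  let Y' : TangentSpace 𝓘(ℝ, E) (c t) := derivWithin Y J t
  Y' + christoffel (c t) (velocity E J c t) (X t)

/-- `c` restricted to `J` is a (smooth) geodesic: `D_t ċ = 0`. -/
structure IsGeodesicOn (E : Type*) [NormedAddCommGroup E] [NormedSpace ℝ E]
    [FiniteDimensional ℝ E] {M : Type*} [MetricSpace M] [ChartedSpace E M]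
    [IsManifold 𝓘(ℝ, E) ∞ M] [RiemannianBundle (fun x : M => TangentSpace 𝓘(ℝ, E) x)]
    (J : Set ℝ) (c : ℝ → M) : Prop where
  smooth : ContMDiffOn 𝓘(ℝ, ℝ) 𝓘(ℝ, E) ∞ c J
  geodesic : ∀ t ∈ J, covDerivAlong (E := E) J c (velocity E J c) t = 0

/-- `c` restricted to `[0, 1]` is a unit speed geodesic segment. -/
structure IsUnitSpeedGeodesic (E : Type*) [NormedAddCommGroup E] [NormedSpace ℝ E]
    [FiniteDimensional ℝ E] {M : Type*} [MetricSpace M] [ChartedSpace E M]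
    [IsManifold 𝓘(ℝ, E) ∞ M] [RiemannianBundle (fun x : M => TangentSpace 𝓘(ℝ, E) x)]
    (c : ℝ → M) : Prop extends IsGeodesicOn E (Icc 0 1) c where
  unit_speed : ∀ t ∈ Icc (0 : ℝ) 1, ‖velocity E (Icc 0 1) c t‖ = 1

/-! ### Partial derivatives of a variation `Ψ : [0,1] × [0,1] × [0,ρ₀] → M` -/

section partials

variable (E : Type*) [NormedAddCommGroup E] [NormedSpace ℝ E]
  {M : Type*} [TopologicalSpace M] [ChartedSpace E M]

/-- `∂_r Ψ (r, s, t)` -/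
def dr (Ψ : ℝ → ℝ → ℝ → M) (r s t : ℝ) : TangentSpace 𝓘(ℝ, E) (Ψ r s t) :=
  velocity E (Icc 0 1) (fun r' => Ψ r' s t) r

/-- `∂_s Ψ (r, s, t)` -/
def ds (Ψ : ℝ → ℝ → ℝ → M) (r s t : ℝ) : TangentSpace 𝓘(ℝ, E) (Ψ r s t) :=
  velocity E (Icc 0 1) (fun s' => Ψ r s' t) s

/-- `∂_t Ψ (r, s, t)` -/
def dt (ρ₀ : ℝ) (Ψ : ℝ → ℝ → ℝ → M) (r s t : ℝ) : TangentSpace 𝓘(ℝ, E) (Ψ r s t) :=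
  velocity E (Icc 0 ρ₀) (fun t' => Ψ r s t') t

end partials

/-- `D_s X (r, s, t)` for a vector field `X` along the variation -/
def Ds (Ψ : ℝ → ℝ → ℝ → M) (X : ∀ r s t, TangentSpace 𝓘(ℝ, E) (Ψ r s t)) (r s t : ℝ) :
    TangentSpace 𝓘(ℝ, E) (Ψ r s t) :=
  covDerivAlong (Icc 0 1) (fun s' => Ψ r s' t) (fun s' => X r s' t) s

/-- `D_t X (r, s, t)` for a vector field `X` along the variation -/
def Dt (ρ₀ : ℝ) (Ψ : ℝ → ℝ → ℝ → M) (X : ∀ r s t, TangentSpace 𝓘(ℝ, E) (Ψ r s t)) (r s t : ℝ) :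
    TangentSpace 𝓘(ℝ, E) (Ψ r s t) :=
  covDerivAlong (Icc 0 ρ₀) (fun t' => Ψ r s t') (fun t' => X r s t') t

/-- `Ψ : [0,1] × [0,1] × [0,ρ₀] → M` is a smooth variation through geodesics such that
`t ↦ Ψ (r, s, t)` is a geodesic from `η r` to `γ s`, parameterized with the constant speed
`d (γ s, η r) / ρ₀`. -/
structure IsGeodesicVariation (E : Type*) [NormedAddCommGroup E] [NormedSpace ℝ E]
    [FiniteDimensional ℝ E] {M : Type*} [MetricSpace M] [ChartedSpace E M]
    [IsManifold 𝓘(ℝ, E) ∞ M] [RiemannianBundle (fun x : M => TangentSpace 𝓘(ℝ, E) x)]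
    (γ η : ℝ → M) (ρ₀ : ℝ) (Ψ : ℝ → ℝ → ℝ → M) : Prop where
  smooth : ContMDiffOn 𝓘(ℝ, ℝ × ℝ × ℝ) 𝓘(ℝ, E) ∞ (fun q : ℝ × ℝ × ℝ => Ψ q.1 q.2.1 q.2.2)
    (Icc 0 1 ×ˢ Icc 0 1 ×ˢ Icc 0 ρ₀)
  geodesic : ∀ r ∈ Icc (0 : ℝ) 1, ∀ s ∈ Icc (0 : ℝ) 1, IsGeodesicOn E (Icc 0 ρ₀) (Ψ r s)
  source : ∀ r ∈ Icc (0 : ℝ) 1, ∀ s ∈ Icc (0 : ℝ) 1, Ψ r s 0 = η r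
  target : ∀ r ∈ Icc (0 : ℝ) 1, ∀ s ∈ Icc (0 : ℝ) 1, Ψ r s ρ₀ = γ s
  speed : ∀ r ∈ Icc (0 : ℝ) 1, ∀ s ∈ Icc (0 : ℝ) 1, ∀ t ∈ Icc (0 : ℝ) ρ₀,
    ‖dt E ρ₀ Ψ r s t‖ = dist (γ s) (η r) / ρ₀

/-- The component of `X` normal to a unit vector `T`: `X - ⟨X, T⟩ T`. -/
def perp {V : Type*} [NormedAddCommGroup V] [InnerProductSpace ℝ V] (T X : V) : V :=
  X - (inner ℝ X T : ℝ) • T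

/-- `∂_r φ` for `φ` considered on `[0,1] × [0,1]` -/
def partialR (φ : ℝ → ℝ → ℝ) (r s : ℝ) : ℝ := derivWithin (fun r' => φ r' s) (Icc 0 1) r

/-- `∂_s φ` for `φ` considered on `[0,1] × [0,1]` -/
def partialS (φ : ℝ → ℝ → ℝ) (r s : ℝ) : ℝ := derivWithin (fun s' => φ r s') (Icc 0 1) s

end GeodVar

end

/-! All the geodesics `Ψ r₀ s` leave from the same point `η r₀`, so their initial velocities T(s) =
∂_tΨ(r₀,s,0) form a curve in one fixed inner product space. The constant speed gives φ = ρ₀|∂_tΨ|,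
hence φ is smooth wherever it is positive. First variation (`hasDerivWithinAt_dist`): the geodesic
equation and the symmetry of mixed derivatives give ∂_t⟨∂_rΨ, ∂_tΨ⟩ = ∂_r|∂_tΨ|²/2. The right side
does not depend on t, and ∂_rΨ = 0 at t = ρ₀ because the target is fixed. Integrating in t yields
∂_rφ(r₀,s) = -⟨V₀, T(s)⟩/|T(s)|, where V₀ does not depend on s. The other two formulas are ordinary
calculus in the fixed space (`derivWithin_neg_bilin_div_sqrt`). Since s ↦ Ψ(r₀,s,0) is constant, D_s
is there the plain derivative, so D_s²∂_tΨ = T'' (`comp_Ds`), and D_tW₀ = T' (`comp_Dt_ds`). At s₀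
one has |T| = 1, and the derivatives of -⟨V₀,T⟩/|T| regroup into normal components. Tangent vectors
are compared through their chart components `comp`, which lie in the model space `E` whatever the
base point. -/

namespace GeodVar

open Filter Topology

/-! ### Tangent vectors, velocities and differentials in chart components -/

section Charts

/-! Shortcut instances, which spare the search the attempt to view the model space as a fiber of a
Riemannian bundle. -/

section Instances

variable {E F : Type*} [NormedAddCommGroup E] [NormedSpace ℝ E]
  [NormedAddCommGroup F] [NormedSpace ℝ F]

noncomputable instance normedAddCommGroupDual : NormedAddCommGroup (E →L[ℝ] F) :=
  ContinuousLinearMap.toNormedAddCommGroup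

noncomputable instance normedAddCommGroupBilin : NormedAddCommGroup (E →L[ℝ] E →L[ℝ] F) :=
  ContinuousLinearMap.toNormedAddCommGroup

end Instances

variable {E : Type*} [NormedAddCommGroup E] [NormedSpace ℝ E]
  {M : Type*} [MetricSpace M] [ChartedSpace E M] [IsManifold 𝓘(ℝ, E) ∞ M]

/-- The components, in the preferred chart at `p`, of a vector `v` tangent to `M` at `x`. -/
noncomputable def comp (p : M) {x : M} (v : TangentSpace 𝓘(ℝ, E) x) : E :=
  (trivializationAt E (TangentSpace 𝓘(ℝ, E)) p (⟨x, v⟩ : TangentBundle 𝓘(ℝ, E) M)).2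

theorem comp_eq_continuousLinearMapAt {p x : M} (hx : x ∈ (chartAt E p).source)
    (v : TangentSpace 𝓘(ℝ, E) x) :
    comp p v = (trivializationAt E (TangentSpace 𝓘(ℝ, E)) p).continuousLinearMapAt ℝ x v := by
  rw [Bundle.Trivialization.continuousLinearMapAt_apply,
    Bundle.Trivialization.coe_linearMapAt_of_mem _ (by simpa using hx)]
  rfl

theorem comp_eq_mfderiv {p x : M} (hx : x ∈ (chartAt E p).source)
    (v : TangentSpace 𝓘(ℝ, E) x) :
    comp p v = mfderiv 𝓘(ℝ, E) 𝓘(ℝ, E) (extChartAt 𝓘(ℝ, E) p) x v := by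
  rw [comp_eq_continuousLinearMapAt hx,
    TangentBundle.continuousLinearMapAt_trivializationAt hx]
  rfl

theorem comp_self (p : M) (v : TangentSpace 𝓘(ℝ, E) p) : comp p v = v := by
  have h := tangentCoordChange_self (I := 𝓘(ℝ, E)) (x := p) (z := p) (v := v)
    (mem_extChartAt_source (I := 𝓘(ℝ, E)) p)
  exact h

theorem comp_zero (p : M) : comp p (0 : TangentSpace 𝓘(ℝ, E) p) = 0 := comp_self p 0

theorem symm_comp {p x : M} (hx : x ∈ (chartAt E p).source) (v : TangentSpace 𝓘(ℝ, E) x) :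
    (trivializationAt E (TangentSpace 𝓘(ℝ, E)) p).symm x (comp p v) = v := by
  have hx' : x ∈ (trivializationAt E (TangentSpace 𝓘(ℝ, E)) p).baseSet := by simpa using hx
  exact (trivializationAt E (TangentSpace 𝓘(ℝ, E)) p).symm_apply_apply_mk hx' v

theorem comp_velocity {p : M} {c : ℝ → M} {J : Set ℝ} {t : ℝ}
    (hc : MDifferentiableWithinAt 𝓘(ℝ, ℝ) 𝓘(ℝ, E) c J t) (hJ : UniqueDiffWithinAt ℝ J t)
    (hp : c t ∈ (chartAt E p).source) :
    comp p (velocity E J c t) = derivWithin (extChartAt 𝓘(ℝ, E) p ∘ c) J t := by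
  have h1 : MDifferentiableAt 𝓘(ℝ, E) 𝓘(ℝ, E) (extChartAt 𝓘(ℝ, E) p) (c t) :=
    mdifferentiableAt_extChartAt hp
  have h2 := h1.hasMFDerivAt.comp_hasMFDerivWithinAt t hc.hasMFDerivWithinAt
  rw [comp_eq_mfderiv hp, derivWithin, ← mfderivWithin_eq_fderivWithin,
    h2.mfderivWithin hJ.uniqueMDiffWithinAt]
  rfl

/-- Stated for components, since the two velocities live in the distinct types of tangent vectors at
`c t` and `c' t`. -/
theorem velocity_congr {c c' : ℝ → M} {J : Set ℝ} {t : ℝ} (h : EqOn c c' J) (ht : t ∈ J) (p : M) :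
    comp p (velocity E J c t) = comp p (velocity E J c' t) := by
  have h1 : c t = c' t := h ht
  have h2 := mfderivWithin_congr (I := 𝓘(ℝ, ℝ)) (I' := 𝓘(ℝ, E)) (s := J) (x := t) h h1
  unfold velocity comp
  rw [h2]
  congr 3

omit [IsManifold 𝓘(ℝ, E) ∞ M] in
theorem velocity_of_eqOn_const {c : ℝ → M} {J : Set ℝ} {t : ℝ} {p : M} (h : ∀ τ ∈ J, c τ = p)
    (ht : t ∈ J) : velocity E J c t = 0 := by
  have h2 := mfderivWithin_congr (I := 𝓘(ℝ, ℝ)) (I' := 𝓘(ℝ, E)) (s := J) (x := t)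
    (f₁ := c) (f := fun _ => p) h (h t ht)
  unfold velocity
  rw [h2, mfderivWithin_const]
  rfl

/-- The differential of a map to a normed space, as a linear map on the model space. -/
noncomputable def diff {F : Type*} [NormedAddCommGroup F] [NormedSpace ℝ F] (f : M → F) (p : M) :
    E →L[ℝ] F :=
  mvfderiv 𝓘(ℝ, E) f p

/-- Evaluation at `v` and `w` is a continuous linear map on bilinear forms, so the chain rule moves
it outside the differential of `G`. -/
theorem mvfderiv_eq_diff_apply {G : M → E →L[ℝ] E →L[ℝ] ℝ} {p : M}
    (hG : MDifferentiableAt 𝓘(ℝ, E) 𝓘(ℝ, E →L[ℝ] E →L[ℝ] ℝ) G p) {f : M → ℝ} {v w : E}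
    (hf : f =ᶠ[𝓝 p] fun x => G x v w) (u : TangentSpace 𝓘(ℝ, E) p) :
    mvfderiv 𝓘(ℝ, E) f p u = diff G p (comp p u) v w := by
  have h1 := (((ContinuousLinearMap.apply ℝ ℝ w).comp
    (ContinuousLinearMap.apply ℝ (E →L[ℝ] ℝ) v)).hasMFDerivAt (x := G p)).comp p hG.hasMFDerivAt
  have hf' : f =ᶠ[𝓝 p] ((ContinuousLinearMap.apply ℝ ℝ w).comp
    (ContinuousLinearMap.apply ℝ (E →L[ℝ] ℝ) v)) ∘ G := hf
  rw [mvfderiv, hf'.mfderiv_eq, h1.mfderiv, comp_self]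
  rfl

theorem hasDerivWithinAt_comp_curve {F : Type*} [NormedAddCommGroup F] [NormedSpace ℝ F]
    {f : M → F} {c : ℝ → M} {J : Set ℝ} {t : ℝ}
    (hf : MDifferentiableAt 𝓘(ℝ, E) 𝓘(ℝ, F) f (c t))
    (hc : MDifferentiableWithinAt 𝓘(ℝ, ℝ) 𝓘(ℝ, E) c J t) :
    HasDerivWithinAt (fun τ => f (c τ)) (diff f (c t) (comp (c t) (velocity E J c t))) J t := by
  have h := hf.hasMFDerivAt.comp_hasMFDerivWithinAt t hc.hasMFDerivWithinAt
  let L : ℝ →L[ℝ] E := mfderivWithin 𝓘(ℝ, ℝ) 𝓘(ℝ, E) c J t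
  have h' : HasFDerivWithinAt (fun τ => f (c τ)) ((diff (E := E) f (c t)).comp L) J t :=
    hasMFDerivWithinAt_iff_hasFDerivWithinAt.1 h
  rw [comp_self]
  exact h'.hasDerivWithinAt

theorem hasDerivWithinAt_bilin_curve {G : M → E →L[ℝ] E →L[ℝ] ℝ} {c : ℝ → M} {J : Set ℝ} {t : ℝ}
    (hG : MDifferentiableAt 𝓘(ℝ, E) 𝓘(ℝ, E →L[ℝ] E →L[ℝ] ℝ) G (c t))
    (hc : MDifferentiableWithinAt 𝓘(ℝ, ℝ) 𝓘(ℝ, E) c J t) {X Y : ℝ → E} {X' Y' : E}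
    (hX : HasDerivWithinAt X X' J t) (hY : HasDerivWithinAt Y Y' J t) :
    HasDerivWithinAt (fun τ => G (c τ) (X τ) (Y τ))
      (diff G (c t) (comp (c t) (velocity E J c t)) (X t) (Y t) + G (c t) X' (Y t) + G (c t) (X t) Y') J t := by
  have h := ((hasDerivWithinAt_comp_curve hG hc).clm_apply hX).clm_apply hY
  exact h.congr_deriv (by simp)

/-- The Christoffel symbols of the first kind for the derivative `D` of a metric. -/
noncomputable def christoffelForm (D : E →L[ℝ] E →L[ℝ] E →L[ℝ] ℝ) (u v : E) : E →L[ℝ] ℝ :=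
  (1 / 2 : ℝ) • (D u v + D v u - (ContinuousLinearMap.apply ℝ ℝ v).comp (D.flip u))

theorem christoffelForm_apply (D : E →L[ℝ] E →L[ℝ] E →L[ℝ] ℝ) (u v w : E) :
    christoffelForm D u v w = (D u v w + D v u w - D w u v) / 2 := by
  simp [christoffelForm]
  ring

theorem christoffelForm_zero_left (D : E →L[ℝ] E →L[ℝ] E →L[ℝ] ℝ) (v : E) :
    christoffelForm D 0 v = 0 := by
  ext w
  simp [christoffelForm_apply]

theorem christoffelForm_zero_right (D : E →L[ℝ] E →L[ℝ] E →L[ℝ] ℝ) (u : E) :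
    christoffelForm D u 0 = 0 := by
  ext w
  simp [christoffelForm_apply]

end Charts

/-! ### The metric and the Christoffel symbols in a chart -/

section Metric

variable {E : Type*} [NormedAddCommGroup E] [NormedSpace ℝ E]
  {M : Type*} [MetricSpace M] [ChartedSpace E M] [IsManifold 𝓘(ℝ, E) ∞ M]
  [RiemannianBundle (fun x : M => TangentSpace 𝓘(ℝ, E) x)]

theorem metricCoeff_eq (p : M) (v w : TangentSpace 𝓘(ℝ, E) p) (x : M) :
    metricCoeff p v w x =
      inner ℝ ((trivializationAt E (TangentSpace 𝓘(ℝ, E)) p).symm x v)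
        ((trivializationAt E (TangentSpace 𝓘(ℝ, E)) p).symm x w) := by
  have hv := comp_self p v
  have hw := comp_self p w
  unfold comp at hv hw
  simp only [metricCoeff, FiberBundle.extend]
  rw [hv, hw]

variable [IsContMDiffRiemannianBundle 𝓘(ℝ, E) ∞ E (fun x : M => TangentSpace 𝓘(ℝ, E) x)]

/-- The Riemannian metric is a smooth section of a bundle of bilinear forms; its expression in the
trivialization at `p` is the required `G`. -/
theorem exists_chartMetric (p : M) : ∃ G : M → E →L[ℝ] E →L[ℝ] ℝ,
    ContMDiffAt 𝓘(ℝ, E) 𝓘(ℝ, E →L[ℝ] E →L[ℝ] ℝ) ∞ G p ∧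
    ∀ x ∈ (chartAt E p).source, ∀ v w : E,
      G x v w = inner ℝ ((trivializationAt E (TangentSpace 𝓘(ℝ, E)) p).symm x v)
        ((trivializationAt E (TangentSpace 𝓘(ℝ, E)) p).symm x w) := by
  obtain ⟨g, g_smooth, hg⟩ := IsContMDiffRiemannianBundle.exists_contMDiff (IB := 𝓘(ℝ, E))
    (n := ∞) (F := E) (E := fun x : M => TangentSpace 𝓘(ℝ, E) x)
  have h := g_smooth p
  rw [contMDiffAt_hom_bundle] at h
  refine ⟨_, h.2, fun x hx v w => ?_⟩
  refine (inCoordinates_apply_eq₂ (by simpa using hx) (by simpa using hx)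
    (Set.mem_univ _)).trans ?_
  rw [hg]
  simp

/-- The metric near `p`, read in the preferred chart at `p`. -/
noncomputable def chartMetric (p : M) : M → E →L[ℝ] E →L[ℝ] ℝ := (exists_chartMetric p).choose

theorem contMDiffAt_chartMetric (p : M) :
    ContMDiffAt 𝓘(ℝ, E) 𝓘(ℝ, E →L[ℝ] E →L[ℝ] ℝ) ∞ (chartMetric (E := E) p) p :=
  (exists_chartMetric p).choose_spec.1

theorem chartMetric_apply {p x : M} (hx : x ∈ (chartAt E p).source) (v w : E) :
    chartMetric p x v w = inner ℝ ((trivializationAt E (TangentSpace 𝓘(ℝ, E)) p).symm x v)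
        ((trivializationAt E (TangentSpace 𝓘(ℝ, E)) p).symm x w) :=
  (exists_chartMetric p).choose_spec.2 x hx v w

theorem inner_eq_chartMetric {p x : M} (hx : x ∈ (chartAt E p).source)
    (v w : TangentSpace 𝓘(ℝ, E) x) : inner ℝ v w = chartMetric p x (comp p v) (comp p w) := by
  rw [chartMetric_apply hx, symm_comp hx v, symm_comp hx w]

theorem chartMetric_symm {p x : M} (hx : x ∈ (chartAt E p).source) (v w : E) :
    chartMetric p x v w = chartMetric p x w v := by
  rw [chartMetric_apply hx, chartMetric_apply hx, real_inner_comm]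

theorem mdifferentiableAt_chartMetric (p : M) :
    MDifferentiableAt 𝓘(ℝ, E) 𝓘(ℝ, E →L[ℝ] E →L[ℝ] ℝ) (chartMetric (E := E) p) p :=
  (contMDiffAt_chartMetric p).mdifferentiableAt (by simp)

theorem mvfderiv_metricCoeff (p : M) (u v w : TangentSpace 𝓘(ℝ, E) p) :
    mvfderiv 𝓘(ℝ, E) (metricCoeff p v w) p u =
      diff (chartMetric (E := E) p) p (comp p u) (comp p v) (comp p w) := by
  refine mvfderiv_eq_diff_apply (mdifferentiableAt_chartMetric p) ?_ u
  filter_upwards [chart_source_mem_nhds E p] with x hx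
  rw [comp_self, comp_self, metricCoeff_eq]
  exact (chartMetric_apply hx v w).symm

theorem diff_chartMetric_symm (p : M) (u : TangentSpace 𝓘(ℝ, E) p) (v w : E) :
    diff (chartMetric (E := E) p) p (comp p u) v w =
      diff (chartMetric (E := E) p) p (comp p u) w v := by
  have hmd := mdifferentiableAt_chartMetric (E := E) p
  have h : (fun x => chartMetric (E := E) p x v w) =ᶠ[𝓝 p]
      fun x => chartMetric (E := E) p x w v := by
    filter_upwards [chart_source_mem_nhds E p] with x hx using chartMetric_symm hx v w
  rw [← mvfderiv_eq_diff_apply hmd (Filter.EventuallyEq.refl _ _) u,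
    mvfderiv_eq_diff_apply hmd h u]

theorem christoffelFirst_eq (p : M) (u v w : TangentSpace 𝓘(ℝ, E) p) :
    christoffelFirst p u v w =
      christoffelForm (diff (chartMetric (E := E) p) p) (comp p u) (comp p v) (comp p w) := by
  rw [christoffelFirst, mvfderiv_metricCoeff, mvfderiv_metricCoeff, mvfderiv_metricCoeff]
  exact (christoffelForm_apply _ _ _ _).symm

/-- The derivative of the scalar product of two vector fields along a curve. -/
theorem hasDerivWithinAt_inner {c : ℝ → M} {J : Set ℝ} {t : ℝ}
    (hc : MDifferentiableWithinAt 𝓘(ℝ, ℝ) 𝓘(ℝ, E) c J t)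
    (X Y : ∀ τ, TangentSpace 𝓘(ℝ, E) (c τ)) {X' Y' : E}
    (hX : HasDerivWithinAt (fun τ => comp (c t) (X τ)) X' J t)
    (hY : HasDerivWithinAt (fun τ => comp (c t) (Y τ)) Y' J t) :
    HasDerivWithinAt (fun τ => (inner ℝ (X τ) (Y τ) : ℝ))
      (diff (chartMetric (E := E) (c t)) (c t) (comp (c t) (velocity E J c t))
          (comp (c t) (X t)) (comp (c t) (Y t))
        + chartMetric (E := E) (c t) (c t) X' (comp (c t) (Y t))
        + chartMetric (E := E) (c t) (c t) (comp (c t) (X t)) Y') J t := by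
  have h := hasDerivWithinAt_bilin_curve (mdifferentiableAt_chartMetric (E := E) (c t)) hc hX hY
  refine h.congr_of_eventuallyEq ?_ ?_
  · filter_upwards [hc.continuousWithinAt (chart_source_mem_nhds E (c t))] with τ hτ
    exact inner_eq_chartMetric hτ _ _
  · exact inner_eq_chartMetric (mem_chart_source E _) _ _

variable [FiniteDimensional ℝ E]

/-- This is the defining property of Γ: expand `w` in the orthonormal basis and use that the symbol
of the first kind is linear in its last argument. -/
theorem inner_christoffel (p : M) (u v w : TangentSpace 𝓘(ℝ, E) p) :
    inner ℝ (christoffel p u v) w =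
      christoffelForm (diff (chartMetric (E := E) p) p) (comp p u) (comp p v) (comp p w) := by
  have hw := (stdOrthonormalBasis ℝ (TangentSpace 𝓘(ℝ, E) p)).sum_repr' w
  let f : TangentSpace 𝓘(ℝ, E) p →ₗ[ℝ] ℝ :=
    (christoffelForm (diff (chartMetric (E := E) p) p) (comp p u) (comp p v)).toLinearMap
  have hf : ∀ w, christoffelFirst p u v w = f w := fun w => by
    rw [christoffelFirst_eq, comp_self p w]
    rfl
  rw [← christoffelFirst_eq, hf w]
  conv_rhs => rw [← hw]
  rw [christoffel, sum_inner, map_sum]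
  refine Finset.sum_congr rfl fun i _ => ?_
  rw [real_inner_smul_left, map_smul, hf, smul_eq_mul, mul_comm]

theorem christoffel_zero_left (p : M) (v : TangentSpace 𝓘(ℝ, E) p) : christoffel p 0 v = 0 := by
  refine Finset.sum_eq_zero fun i _ => ?_
  rw [christoffelFirst_eq, comp_zero, christoffelForm_zero_left]
  exact zero_smul _ _

theorem christoffel_zero_right (p : M) (v : TangentSpace 𝓘(ℝ, E) p) : christoffel p v 0 = 0 := by
  refine Finset.sum_eq_zero fun i _ => ?_
  rw [christoffelFirst_eq, comp_zero, christoffelForm_zero_right]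
  exact zero_smul _ _

end Metric

/-! ### Derivatives along coordinate lines of a map on a parameter domain -/

section Slices

variable {E : Type*} [NormedAddCommGroup E] [NormedSpace ℝ E]
  {M : Type*} [MetricSpace M] [ChartedSpace E M] [IsManifold 𝓘(ℝ, E) ∞ M]
  {W : Type*} [NormedAddCommGroup W] [NormedSpace ℝ W] {F : W → M} {B : Set W}

theorem contDiffWithinAt_chart_comp (hF : ContMDiffOn 𝓘(ℝ, W) 𝓘(ℝ, E) ∞ F B) {q : W} (hq : q ∈ B)
    {p : M} (hp : F q ∈ (chartAt E p).source) :
    ContDiffWithinAt ℝ ∞ (extChartAt 𝓘(ℝ, E) p ∘ F) B q := by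
  have h1 : ContMDiffAt 𝓘(ℝ, E) 𝓘(ℝ, E) ∞ (extChartAt 𝓘(ℝ, E) p) (F q) :=
    contMDiffAt_extChartAt' hp
  exact (h1.comp_contMDiffWithinAt q (hF q hq)).contDiffWithinAt

omit [IsManifold 𝓘(ℝ, E) ∞ M] in
theorem mdifferentiableWithinAt_slice (hF : ContMDiffOn 𝓘(ℝ, W) 𝓘(ℝ, E) ∞ F B) {l : ℝ → W} {e : W}
    {J : Set ℝ} {τ : ℝ} (hl : HasDerivWithinAt l e J τ) (hJB : MapsTo l J B) (hτ : τ ∈ J) :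
    MDifferentiableWithinAt 𝓘(ℝ, ℝ) 𝓘(ℝ, E) (F ∘ l) J τ :=
  ((hF (l τ) (hJB hτ)).mdifferentiableWithinAt (by simp)).comp τ
    hl.differentiableWithinAt.mdifferentiableWithinAt hJB

/-- Every partial velocity is a value of the one Fréchet derivative within `B`; mixed partials thus
become values of a single second derivative. -/
theorem comp_velocity_slice (hF : ContMDiffOn 𝓘(ℝ, W) 𝓘(ℝ, E) ∞ F B) {l : ℝ → W} {e : W}
    {J : Set ℝ} {τ : ℝ} (hl : HasDerivWithinAt l e J τ) (hJB : MapsTo l J B) (hτ : τ ∈ J)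
    (hJ : UniqueDiffWithinAt ℝ J τ) {p : M} (hp : F (l τ) ∈ (chartAt E p).source) :
    comp p (velocity E J (F ∘ l) τ) =
      fderivWithin ℝ (extChartAt 𝓘(ℝ, E) p ∘ F) B (l τ) e := by
  rw [comp_velocity (mdifferentiableWithinAt_slice hF hl hJB hτ) hJ hp]
  have h1 := ((contDiffWithinAt_chart_comp hF (hJB hτ) hp).differentiableWithinAt
    (by simp)).hasFDerivWithinAt
  exact (h1.comp_hasDerivWithinAt τ hl hJB).derivWithin hJ

theorem hasDerivWithinAt_fderivWithin_slice (hF : ContMDiffOn 𝓘(ℝ, W) 𝓘(ℝ, E) ∞ F B)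
    (hB : UniqueDiffOn ℝ B) {l : ℝ → W} {d : W} (e : W)
    {J : Set ℝ} {τ : ℝ} (hl : HasDerivWithinAt l d J τ) (hJB : MapsTo l J B) (hτ : τ ∈ J)
    {p : M} (hp : F (l τ) ∈ (chartAt E p).source) :
    HasDerivWithinAt (fun τ => fderivWithin ℝ (extChartAt 𝓘(ℝ, E) p ∘ F) B (l τ) e)
      (fderivWithin ℝ (fderivWithin ℝ (extChartAt 𝓘(ℝ, E) p ∘ F) B) B (l τ) d e) J τ := by
  have h1 : ContDiffWithinAt ℝ ∞ (fderivWithin ℝ (extChartAt 𝓘(ℝ, E) p ∘ F) B) B (l τ) :=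
    (contDiffWithinAt_chart_comp hF (hJB hτ) hp).fderivWithin_right hB (by simp) (hJB hτ)
  have h2 := (h1.differentiableWithinAt (by simp)).hasFDerivWithinAt
  have h3 := h2.comp_hasDerivWithinAt τ hl hJB
  exact (h3.clm_apply (hasDerivWithinAt_const τ J e)).congr_deriv (by simp)

theorem hasDerivWithinAt_comp_velocity (hF : ContMDiffOn 𝓘(ℝ, W) 𝓘(ℝ, E) ∞ F B)
    (hB : UniqueDiffOn ℝ B) {l : ℝ → W} {d : W} {e : W}
    {J : Set ℝ} {τ : ℝ} (hl : HasDerivWithinAt l d J τ) (hJB : MapsTo l J B) (hτ : τ ∈ J)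
    {p : M} (hp : F (l τ) ∈ (chartAt E p).source) {X : ∀ τ, TangentSpace 𝓘(ℝ, E) (F (l τ))}
    (hX : ∀ τ ∈ J, F (l τ) ∈ (chartAt E p).source →
      comp p (X τ) = fderivWithin ℝ (extChartAt 𝓘(ℝ, E) p ∘ F) B (l τ) e) :
    HasDerivWithinAt (fun τ => comp p (X τ))
      (fderivWithin ℝ (fderivWithin ℝ (extChartAt 𝓘(ℝ, E) p ∘ F) B) B (l τ) d e) J τ := by
  refine (hasDerivWithinAt_fderivWithin_slice hF hB e hl hJB hτ hp).congr_of_eventuallyEq ?_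
    (hX τ hτ hp)
  have hc := (mdifferentiableWithinAt_slice hF hl hJB hτ).continuousWithinAt
  filter_upwards [hc ((chartAt E p).open_source.mem_nhds hp), self_mem_nhdsWithin] with σ h1 h2
  exact hX σ h2 h1

end Slices

/-! ### Partial derivatives of a variation in a chart -/

section Box

variable {E : Type*} [NormedAddCommGroup E] [NormedSpace ℝ E]
  {M : Type*} [MetricSpace M] [ChartedSpace E M] [IsManifold 𝓘(ℝ, E) ∞ M]
  {ρ : ℝ} {Ψ : ℝ → ℝ → ℝ → M}

/-- The parameter domain of a variation. -/
def box (ρ : ℝ) : Set (ℝ × ℝ × ℝ) := Icc 0 1 ×ˢ Icc 0 1 ×ˢ Icc 0 ρ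

/-- The second derivative, in directions `d` and `e`, of a variation read in the chart at `p`. -/
noncomputable def chartHessian (E : Type*) [NormedAddCommGroup E] [NormedSpace ℝ E]
    {M : Type*} [TopologicalSpace M] [ChartedSpace E M]
    (ρ : ℝ) (Ψ : ℝ → ℝ → ℝ → M) (p : M) (q d e : ℝ × ℝ × ℝ) : E :=
  fderivWithin ℝ (fderivWithin ℝ
    (extChartAt 𝓘(ℝ, E) p ∘ fun q : ℝ × ℝ × ℝ => Ψ q.1 q.2.1 q.2.2) (box ρ)) (box ρ) q d e

theorem uniqueDiffOn_box (hρ : 0 < ρ) : UniqueDiffOn ℝ (box ρ) :=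
  (uniqueDiffOn_Icc one_pos).prod ((uniqueDiffOn_Icc one_pos).prod (uniqueDiffOn_Icc hρ))

theorem subset_closure_interior_box (hρ : 0 < ρ) : box ρ ⊆ closure (interior (box ρ)) := by
  simp only [box, interior_prod_eq, closure_prod_eq, interior_Icc, closure_Ioo one_pos.ne,
    closure_Ioo hρ.ne, subset_refl]

/-- Symmetry persists at the faces and corners because the box lies in the closure of its interior.
-/
theorem chartHessian_symm (hρ : 0 < ρ)
    (hΨ : ContMDiffOn 𝓘(ℝ, ℝ × ℝ × ℝ) 𝓘(ℝ, E) ∞ (fun q : ℝ × ℝ × ℝ => Ψ q.1 q.2.1 q.2.2) (box ρ))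
    {q : ℝ × ℝ × ℝ} (hq : q ∈ box ρ) {p : M} (hp : Ψ q.1 q.2.1 q.2.2 ∈ (chartAt E p).source)
    (d e : ℝ × ℝ × ℝ) : chartHessian E ρ Ψ p q d e = chartHessian E ρ Ψ p q e d :=
  ((contDiffWithinAt_chart_comp hΨ hq hp).isSymmSndFDerivWithinAt
    (by simpa using (inferInstance : ENat.LEInfty 2).out)
    (uniqueDiffOn_box hρ) (subset_closure_interior_box hρ hq) hq).eq d e

theorem hasDerivWithinAt_lineR (r s t : ℝ) (J : Set ℝ) :
    HasDerivWithinAt (fun r' => ((r', s, t) : ℝ × ℝ × ℝ)) (1, 0, 0) J r :=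
  (hasDerivWithinAt_id r J).prodMk (hasDerivWithinAt_const r J (s, t))

theorem hasDerivWithinAt_lineS (r s t : ℝ) (J : Set ℝ) :
    HasDerivWithinAt (fun s' => ((r, s', t) : ℝ × ℝ × ℝ)) (0, 1, 0) J s :=
  (hasDerivWithinAt_const s J r).prodMk
    ((hasDerivWithinAt_id s J).prodMk (hasDerivWithinAt_const s J t))

theorem hasDerivWithinAt_lineT (r s t : ℝ) (J : Set ℝ) :
    HasDerivWithinAt (fun t' => ((r, s, t') : ℝ × ℝ × ℝ)) (0, 0, 1) J t :=
  (hasDerivWithinAt_const t J r).prodMk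
    ((hasDerivWithinAt_const t J s).prodMk (hasDerivWithinAt_id t J))

variable {r s t : ℝ}

theorem mapsTo_lineR (hs : s ∈ Icc (0 : ℝ) 1) (ht : t ∈ Icc 0 ρ) :
    MapsTo (fun r' => ((r', s, t) : ℝ × ℝ × ℝ)) (Icc 0 1) (box ρ) :=
  fun _ h => ⟨h, hs, ht⟩

theorem mapsTo_lineS (hr : r ∈ Icc (0 : ℝ) 1) (ht : t ∈ Icc 0 ρ) :
    MapsTo (fun s' => ((r, s', t) : ℝ × ℝ × ℝ)) (Icc 0 1) (box ρ) :=
  fun _ h => ⟨hr, h, ht⟩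

theorem mapsTo_lineT (hr : r ∈ Icc (0 : ℝ) 1) (hs : s ∈ Icc (0 : ℝ) 1) :
    MapsTo (fun t' => ((r, s, t') : ℝ × ℝ × ℝ)) (Icc 0 ρ) (box ρ) :=
  fun _ h => ⟨hr, hs, h⟩

variable
  (hΨ : ContMDiffOn 𝓘(ℝ, ℝ × ℝ × ℝ) 𝓘(ℝ, E) ∞ (fun q : ℝ × ℝ × ℝ => Ψ q.1 q.2.1 q.2.2) (box ρ))
  (hr : r ∈ Icc (0 : ℝ) 1) (hs : s ∈ Icc (0 : ℝ) 1) (ht : t ∈ Icc 0 ρ)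
  {p : M} (hp : Ψ r s t ∈ (chartAt E p).source)

include hΨ hr hs ht hp

theorem comp_dr : comp p (dr E Ψ r s t) =
    fderivWithin ℝ (extChartAt 𝓘(ℝ, E) p ∘ fun q : ℝ × ℝ × ℝ => Ψ q.1 q.2.1 q.2.2) (box ρ)
      (r, s, t) (1, 0, 0) :=
  comp_velocity_slice hΨ (hasDerivWithinAt_lineR r s t _) (mapsTo_lineR hs ht) hr
    (uniqueDiffOn_Icc one_pos r hr) hp

theorem comp_ds : comp p (ds E Ψ r s t) =
    fderivWithin ℝ (extChartAt 𝓘(ℝ, E) p ∘ fun q : ℝ × ℝ × ℝ => Ψ q.1 q.2.1 q.2.2) (box ρ)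
      (r, s, t) (0, 1, 0) :=
  comp_velocity_slice hΨ (hasDerivWithinAt_lineS r s t _) (mapsTo_lineS hr ht) hs
    (uniqueDiffOn_Icc one_pos s hs) hp

theorem comp_dt (hρ : 0 < ρ) : comp p (dt E ρ Ψ r s t) =
    fderivWithin ℝ (extChartAt 𝓘(ℝ, E) p ∘ fun q : ℝ × ℝ × ℝ => Ψ q.1 q.2.1 q.2.2) (box ρ)
      (r, s, t) (0, 0, 1) :=
  comp_velocity_slice hΨ (hasDerivWithinAt_lineT r s t _) (mapsTo_lineT hr hs) ht
    (uniqueDiffOn_Icc hρ t ht) hp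

theorem hasDerivWithinAt_comp_dt_r (hρ : 0 < ρ) :
    HasDerivWithinAt (fun r' => comp p (dt E ρ Ψ r' s t))
      (chartHessian E ρ Ψ p (r, s, t) (1, 0, 0) (0, 0, 1)) (Icc 0 1) r :=
  hasDerivWithinAt_comp_velocity hΨ (uniqueDiffOn_box hρ) (hasDerivWithinAt_lineR r s t _)
    (mapsTo_lineR hs ht) hr hp fun _ h h' => comp_dt hΨ h hs ht h' hρ

theorem hasDerivWithinAt_comp_dr_t (hρ : 0 < ρ) :
    HasDerivWithinAt (fun t' => comp p (dr E Ψ r s t'))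
      (chartHessian E ρ Ψ p (r, s, t) (0, 0, 1) (1, 0, 0)) (Icc 0 ρ) t :=
  hasDerivWithinAt_comp_velocity hΨ (uniqueDiffOn_box hρ) (hasDerivWithinAt_lineT r s t _)
    (mapsTo_lineT hr hs) ht hp fun _ h h' => comp_dr hΨ hr hs h h'

theorem hasDerivWithinAt_comp_dt_s (hρ : 0 < ρ) :
    HasDerivWithinAt (fun s' => comp p (dt E ρ Ψ r s' t))
      (chartHessian E ρ Ψ p (r, s, t) (0, 1, 0) (0, 0, 1)) (Icc 0 1) s :=
  hasDerivWithinAt_comp_velocity hΨ (uniqueDiffOn_box hρ) (hasDerivWithinAt_lineS r s t _)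
    (mapsTo_lineS hr ht) hs hp fun _ h h' => comp_dt hΨ hr h ht h' hρ

theorem hasDerivWithinAt_comp_ds_t (hρ : 0 < ρ) :
    HasDerivWithinAt (fun t' => comp p (ds E Ψ r s t'))
      (chartHessian E ρ Ψ p (r, s, t) (0, 0, 1) (0, 1, 0)) (Icc 0 ρ) t :=
  hasDerivWithinAt_comp_velocity hΨ (uniqueDiffOn_box hρ) (hasDerivWithinAt_lineT r s t _)
    (mapsTo_lineT hr hs) ht hp fun _ h h' => comp_ds hΨ hr hs h h'

theorem hasDerivWithinAt_comp_dt_t (hρ : 0 < ρ) :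
    HasDerivWithinAt (fun t' => comp p (dt E ρ Ψ r s t'))
      (chartHessian E ρ Ψ p (r, s, t) (0, 0, 1) (0, 0, 1)) (Icc 0 ρ) t :=
  hasDerivWithinAt_comp_velocity hΨ (uniqueDiffOn_box hρ) (hasDerivWithinAt_lineT r s t _)
    (mapsTo_lineT hr hs) ht hp fun _ h h' => comp_dt hΨ hr hs h h' hρ

end Box

/-! ### Two cases in which the Christoffel term of `covDerivAlong` vanishes -/

section CovariantDerivative

variable {E : Type*} [NormedAddCommGroup E] [NormedSpace ℝ E] [FiniteDimensional ℝ E]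
  {M : Type*} [MetricSpace M] [ChartedSpace E M] [IsManifold 𝓘(ℝ, E) ∞ M]
  [RiemannianBundle (fun x : M => TangentSpace 𝓘(ℝ, E) x)]

theorem comp_covDerivAlong_self (J : Set ℝ) (c : ℝ → M) (X : ∀ t, TangentSpace 𝓘(ℝ, E) (c t))
    (t : ℝ) : comp (c t) (covDerivAlong J c X t) =
      derivWithin (fun τ => comp (c t) (X τ)) J t
        + comp (c t) (christoffel (c t) (velocity E J c t) (X t)) := by
  rw [comp_self, comp_self]
  rfl

variable [IsContMDiffRiemannianBundle 𝓘(ℝ, E) ∞ E (fun x : M => TangentSpace 𝓘(ℝ, E) x)]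

theorem comp_covDerivAlong_of_const {J : Set ℝ} {c : ℝ → M} (X : ∀ t, TangentSpace 𝓘(ℝ, E) (c t))
    {t : ℝ} {p : M} (hc : ∀ τ ∈ J, c τ = p) (ht : t ∈ J) :
    comp p (covDerivAlong J c X t) = derivWithin (fun τ => comp p (X τ)) J t := by
  obtain rfl : c t = p := hc t ht
  rw [comp_covDerivAlong_self, velocity_of_eqOn_const hc ht, christoffel_zero_left, comp_zero,
    add_zero]

theorem comp_covDerivAlong_of_eq_zero {J : Set ℝ} {c : ℝ → M}
    (X : ∀ t, TangentSpace 𝓘(ℝ, E) (c t)) {t : ℝ} (hX : X t = 0) :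
    comp (c t) (covDerivAlong J c X t) = derivWithin (fun τ => comp (c t) (X τ)) J t := by
  rw [comp_covDerivAlong_self, hX, christoffel_zero_right, comp_zero, add_zero]

end CovariantDerivative

/-! ### The infinitesimal first variation identity -/

section FirstVariation

variable {E : Type*} [NormedAddCommGroup E] [NormedSpace ℝ E] [FiniteDimensional ℝ E]
  {M : Type*} [MetricSpace M] [ChartedSpace E M] [IsManifold 𝓘(ℝ, E) ∞ M]
  [RiemannianBundle (fun x : M => TangentSpace 𝓘(ℝ, E) x)]
  [IsContMDiffRiemannianBundle 𝓘(ℝ, E) ∞ E (fun x : M => TangentSpace 𝓘(ℝ, E) x)]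
  {ρ : ℝ} {Ψ : ℝ → ℝ → ℝ → M}
  {r s t : ℝ}

/-- Along a variation through geodesics, `∂_t ⟨∂_r Ψ, ∂_t Ψ⟩ = ∂_r |∂_t Ψ|² / 2`. -/
theorem exists_hasDerivWithinAt_inner_dr_dt (hρ : 0 < ρ)
    (hΨ : ContMDiffOn 𝓘(ℝ, ℝ × ℝ × ℝ) 𝓘(ℝ, E) ∞ (fun q : ℝ × ℝ × ℝ => Ψ q.1 q.2.1 q.2.2) (box ρ))
    (hr : r ∈ Icc (0 : ℝ) 1) (hs : s ∈ Icc (0 : ℝ) 1) (ht : t ∈ Icc 0 ρ)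
    (hgeo : IsGeodesicOn E (Icc 0 ρ) (Ψ r s)) :
    ∃ k : ℝ, HasDerivWithinAt
        (fun t' => (inner ℝ (dr E Ψ r s t') (dt E ρ Ψ r s t') : ℝ)) k (Icc 0 ρ) t ∧
      HasDerivWithinAt
        (fun r' => (inner ℝ (dt E ρ Ψ r' s t) (dt E ρ Ψ r' s t) : ℝ)) (2 * k) (Icc 0 1) r := by
  have hp : Ψ r s t ∈ (chartAt E (Ψ r s t)).source := mem_chart_source E _
  have hmt : MDifferentiableWithinAt 𝓘(ℝ, ℝ) 𝓘(ℝ, E) (fun t' => Ψ r s t') (Icc 0 ρ) t :=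
    mdifferentiableWithinAt_slice hΨ (hasDerivWithinAt_lineT r s t _) (mapsTo_lineT hr hs) ht
  have hmr : MDifferentiableWithinAt 𝓘(ℝ, ℝ) 𝓘(ℝ, E) (fun r' => Ψ r' s t) (Icc 0 1) r :=
    mdifferentiableWithinAt_slice hΨ (hasDerivWithinAt_lineR r s t _) (mapsTo_lineR hs ht) hr
  have h1 := hasDerivWithinAt_inner hmt (dr E Ψ r s) (dt E ρ Ψ r s)
    (hasDerivWithinAt_comp_dr_t hΨ hr hs ht hp hρ) (hasDerivWithinAt_comp_dt_t hΨ hr hs ht hp hρ)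
  have h2 := hasDerivWithinAt_inner hmr (fun r' => dt E ρ Ψ r' s t) (fun r' => dt E ρ Ψ r' s t)
    (hasDerivWithinAt_comp_dt_r hΨ hr hs ht hp hρ) (hasDerivWithinAt_comp_dt_r hΨ hr hs ht hp hρ)
  refine ⟨_, h1, h2.congr_deriv ?_⟩
  -- The geodesic equation, in components, reads ∂_t∂_tΨ = -Γ(∂_tΨ, ∂_tΨ).
  have hg : comp (Ψ r s t) (covDerivAlong (Icc 0 ρ) (Ψ r s) (velocity E (Icc 0 ρ) (Ψ r s)) t) =
      0 := by
    rw [hgeo.geodesic t ht, comp_zero]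
  rw [comp_covDerivAlong_self] at hg
  have hd := (hasDerivWithinAt_comp_dt_t hΨ hr hs ht hp hρ).derivWithin (uniqueDiffOn_Icc hρ t ht)
  change derivWithin (fun τ => comp (Ψ r s t) (velocity E (Icc 0 ρ) (Ψ r s) τ)) _ _ = _ at hd
  rw [hd] at hg
  have hdd := eq_neg_of_add_eq_zero_left hg
  -- With T = ∂_tΨ and V = ∂_rΨ: ⟨Γ(T,T), V⟩ = (D_T g)(T,V) - (D_V g)(T,T)/2. The first term cancels
  -- against the derivative of the metric in `h1`, leaving half of the derivative in `h2`.
  have hi := inner_eq_chartMetric hp (christoffel (Ψ r s t) (velocity E (Icc 0 ρ) (Ψ r s) t)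
    (velocity E (Icc 0 ρ) (Ψ r s) t)) (dr E Ψ r s t)
  rw [inner_christoffel, christoffelForm_apply] at hi
  change _ = chartMetric (Ψ r s t) (Ψ r s t) _ _ at hi
  have hsymm := diff_chartMetric_symm (E := E) (Ψ r s t) (dt E ρ Ψ r s t)
    (comp (Ψ r s t) (dr E Ψ r s t)) (comp (Ψ r s t) (dt E ρ Ψ r s t))
  rw [hdd, chartHessian_symm hρ hΨ (q := (r, s, t)) ⟨hr, hs, ht⟩ hp (0, 0, 1) (1, 0, 0), map_neg,
    chartMetric_symm hp _ (comp (Ψ r s t) (christoffel _ _ _)), ← hi,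
    chartMetric_symm hp (comp (Ψ r s t) (dt E ρ Ψ r s t))]
  change _ = 2 * (diff (chartMetric (Ψ r s t)) (Ψ r s t) (comp (Ψ r s t) (dt E ρ Ψ r s t)) _ _
    + _ + _)
  rw [hsymm]
  simp only [dt, dr]
  ring

end FirstVariation

/-! ### Calculus in a fixed inner product space -/

section Calculus

variable {E : Type*} [NormedAddCommGroup E] [NormedSpace ℝ E]

/-- The first two derivatives of the cosine `⟨v, T⟩ / |T|`, up to sign, at a unit vector `T`. -/
theorem derivWithin_neg_bilin_div_sqrt {G : E →L[ℝ] E →L[ℝ] ℝ} (hG : ∀ x y, G x y = G y x)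
    {J : Set ℝ} (hJ : UniqueDiffOn ℝ J) {T T₁ : ℝ → E} {T₂ v : E} {s : ℝ} (hs : s ∈ J)
    (hT : ∀ τ ∈ J, HasDerivWithinAt T (T₁ τ) J τ) (hT₁ : HasDerivWithinAt T₁ T₂ J s)
    (hpos : ∀ τ ∈ J, 0 < G (T τ) (T τ)) (hone : G (T s) (T s) = 1) {f : ℝ → ℝ}
    (hf : ∀ τ ∈ J, f τ = -(G v (T τ)) / √(G (T τ) (T τ))) :
    derivWithin f J s = -(G v (T₁ s)) + G v (T s) * G (T s) (T₁ s) ∧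
    derivWithin (derivWithin f J) J s = -(G v T₂) + 2 * G v (T₁ s) * G (T s) (T₁ s)
      + G v (T s) * (G (T₁ s) (T₁ s) + G (T s) T₂) - 3 * G v (T s) * G (T s) (T₁ s) ^ 2 := by
  have hlin : ∀ {X : ℝ → E} {X' : E} {τ : ℝ}, HasDerivWithinAt X X' J τ →
      HasDerivWithinAt (fun τ => -(G v (X τ))) (-(G v X')) J τ := fun h =>
    ((G v).hasFDerivAt.comp_hasDerivWithinAt _ h).neg
  have hbil : ∀ {X Y : ℝ → E} {X' Y' : E} {τ : ℝ}, HasDerivWithinAt X X' J τ →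
      HasDerivWithinAt Y Y' J τ →
      HasDerivWithinAt (fun τ => G (X τ) (Y τ)) (G X' (Y τ) + G (X τ) Y') J τ := fun hX hY =>
    (G.hasFDerivAt.comp_hasDerivWithinAt _ hX).clm_apply hY
  have hn : ∀ τ ∈ J, HasDerivWithinAt (fun τ => √(G (T τ) (T τ)))
      (G (T τ) (T₁ τ) / √(G (T τ) (T τ))) J τ := fun τ hτ => by
    refine ((hbil (hT τ hτ) (hT τ hτ)).sqrt (hpos τ hτ).ne').congr_deriv ?_
    rw [hG (T₁ τ), ← two_mul, mul_div_mul_left _ _ two_ne_zero]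
  have hn0 : ∀ τ ∈ J, √(G (T τ) (T τ)) ≠ 0 := fun τ hτ => (Real.sqrt_pos.2 (hpos τ hτ)).ne'
  have hf' : ∀ τ ∈ J, derivWithin f J τ = (-(G v (T₁ τ)) * √(G (T τ) (T τ))
      - -(G v (T τ)) * (G (T τ) (T₁ τ) / √(G (T τ) (T τ)))) / √(G (T τ) (T τ)) ^ 2 :=
    fun τ hτ => (((hlin (hT τ hτ)).div (hn τ hτ) (hn0 τ hτ)).congr hf (hf τ hτ)).derivWithin
      (hJ τ hτ)
  constructor
  · rw [hf' s hs, hone]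
    simp
  · have h1 := (hlin hT₁).mul (hn s hs)
    have h2 := (hlin (hT s hs)).mul ((hbil (hT s hs) hT₁).div (hn s hs) (hn0 s hs))
    have h3 := (h1.sub h2).div ((hn s hs).pow 2) (pow_ne_zero 2 (hn0 s hs))
    rw [(h3.congr hf' (hf' s hs)).derivWithin (hJ s hs)]
    simp [hone]
    ring

theorem inner_perp_perp {V : Type*} [NormedAddCommGroup V] [InnerProductSpace ℝ V] {T : V}
    (hT : inner ℝ T T = (1 : ℝ)) (X Y : V) :
    (inner ℝ (perp T X) (perp T Y) : ℝ) = inner ℝ X Y - inner ℝ X T * inner ℝ Y T := by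
  simp only [perp, inner_sub_left, inner_sub_right, real_inner_smul_left, real_inner_smul_right, hT]
  rw [real_inner_comm Y T]
  ring

end Calculus

/-! ### Smoothness of the distance, first variation, and derivatives at the common source -/

section Variation

variable {E : Type*} [NormedAddCommGroup E] [NormedSpace ℝ E] [FiniteDimensional ℝ E]
  {M : Type*} [MetricSpace M] [ChartedSpace E M] [IsManifold 𝓘(ℝ, E) ∞ M]
  [RiemannianBundle (fun x : M => TangentSpace 𝓘(ℝ, E) x)]
  {γ η : ℝ → M} {ρ : ℝ} {Ψ : ℝ → ℝ → ℝ → M} {r s t : ℝ}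

namespace IsGeodesicVariation

theorem inner_dt_self (h : IsGeodesicVariation E γ η ρ Ψ)
    (hr : r ∈ Icc (0 : ℝ) 1) (hs : s ∈ Icc (0 : ℝ) 1) (ht : t ∈ Icc 0 ρ) :
    (inner ℝ (dt E ρ Ψ r s t) (dt E ρ Ψ r s t) : ℝ) = (dist (γ s) (η r) / ρ) ^ 2 := by
  rw [real_inner_self_eq_norm_sq, h.speed r hr s hs t ht]

theorem dist_eq_sqrt_inner (h : IsGeodesicVariation E γ η ρ Ψ) (hρ : 0 < ρ)
    (hr : r ∈ Icc (0 : ℝ) 1) (hs : s ∈ Icc (0 : ℝ) 1) (ht : t ∈ Icc 0 ρ) :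
    dist (γ s) (η r) = ρ * √(inner ℝ (dt E ρ Ψ r s t) (dt E ρ Ψ r s t)) := by
  rw [h.inner_dt_self hr hs ht, Real.sqrt_sq (by positivity), mul_div_cancel₀ _ hρ.ne']

/-- The initial velocities of the geodesics from a fixed point vary smoothly. -/
theorem contDiffOn_comp_dt (h : IsGeodesicVariation E γ η ρ Ψ) (hρ : 0 < ρ)
    (hr : r ∈ Icc (0 : ℝ) 1) :
    ContDiffOn ℝ ∞ (fun s => comp (η r) (dt E ρ Ψ r s 0)) (Icc 0 1) := by
  intro s hs
  have h0 : (0 : ℝ) ∈ Icc 0 ρ := ⟨le_rfl, hρ.le⟩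
  have hp : ∀ s ∈ Icc (0 : ℝ) 1, Ψ r s 0 ∈ (chartAt E (η r)).source := fun s hs => by
    rw [h.source r hr s hs]
    exact mem_chart_source E _
  have hι : ContDiffWithinAt ℝ ∞ (fun s => ((r, s, 0) : ℝ × ℝ × ℝ)) (Icc 0 1) s := by
    fun_prop
  exact ((((contDiffWithinAt_chart_comp h.smooth (q := (r, s, 0)) ⟨hr, hs, h0⟩
    (hp s hs)).fderivWithin_right (uniqueDiffOn_box hρ) (by simp) ⟨hr, hs, h0⟩).comp s hι
      (mapsTo_lineS hr h0)).clm_apply contDiffWithinAt_const).congr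
    (fun s hs => comp_dt h.smooth hr hs h0 (hp s hs) hρ) (comp_dt h.smooth hr hs h0 (hp s hs) hρ)

/-- At t = 0 the variation in r traces `η`, whatever s is. -/
theorem comp_dr_source (h : IsGeodesicVariation E γ η ρ Ψ) (hr : r ∈ Icc (0 : ℝ) 1) {s' : ℝ}
    (hs : s ∈ Icc (0 : ℝ) 1) (hs' : s' ∈ Icc (0 : ℝ) 1) (p : M) :
    comp p (dr E Ψ r s 0) = comp p (dr E Ψ r s' 0) :=
  velocity_congr (fun r' hr' => (h.source r' hr' s hs).trans (h.source r' hr' s' hs').symm) hr p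

variable [IsContMDiffRiemannianBundle 𝓘(ℝ, E) ∞ E (fun x : M => TangentSpace 𝓘(ℝ, E) x)]

theorem contDiffOn_inner_dt (h : IsGeodesicVariation E γ η ρ Ψ) (hρ : 0 < ρ) (ht : t ∈ Icc 0 ρ) :
    ContDiffOn ℝ ∞ (fun q : ℝ × ℝ => (inner ℝ (dt E ρ Ψ q.1 q.2 t) (dt E ρ Ψ q.1 q.2 t) : ℝ))
      (Icc 0 1 ×ˢ Icc 0 1) := by
  intro q hq
  let p := Ψ q.1 q.2 t
  have hp : Ψ q.1 q.2 t ∈ (chartAt E p).source := mem_chart_source E _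
  let ι : ℝ × ℝ → ℝ × ℝ × ℝ := fun q => (q.1, q.2, t)
  have hι : ContDiffWithinAt ℝ ∞ ι (Icc 0 1 ×ˢ Icc 0 1) q := by
    unfold ι
    fun_prop
  have hιB : MapsTo ι (Icc 0 1 ×ˢ Icc 0 1) (box ρ) := fun q hq => ⟨hq.1, hq.2, ht⟩
  have hu : ContDiffWithinAt ℝ ∞ (fun q => fderivWithin ℝ (extChartAt 𝓘(ℝ, E) p ∘
      fun q : ℝ × ℝ × ℝ => Ψ q.1 q.2.1 q.2.2) (box ρ) (ι q) (0, 0, 1))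
      (Icc 0 1 ×ˢ Icc 0 1) q :=
    (((contDiffWithinAt_chart_comp h.smooth (hιB hq) hp).fderivWithin_right
      (uniqueDiffOn_box hρ) (by simp) (hιB hq)).comp q hι hιB).clm_apply contDiffWithinAt_const
  have hΨ := (h.smooth _ (hιB hq)).comp q hι.contMDiffWithinAt hιB
  have hm : ContDiffWithinAt ℝ ∞ (fun q : ℝ × ℝ => chartMetric (E := E) p (Ψ q.1 q.2 t))
      (Icc 0 1 ×ˢ Icc 0 1) q :=
    ((contMDiffAt_chartMetric p).comp_contMDiffWithinAt q hΨ).contDiffWithinAt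
  have heq : ∀ q ∈ Icc (0 : ℝ) 1 ×ˢ Icc (0 : ℝ) 1, Ψ q.1 q.2 t ∈ (chartAt E p).source →
      (inner ℝ (dt E ρ Ψ q.1 q.2 t) (dt E ρ Ψ q.1 q.2 t) : ℝ) = chartMetric (E := E) p (Ψ q.1 q.2 t)
        (fderivWithin ℝ (extChartAt 𝓘(ℝ, E) p ∘ fun q : ℝ × ℝ × ℝ => Ψ q.1 q.2.1 q.2.2) (box ρ)
          (ι q) (0, 0, 1))
        (fderivWithin ℝ (extChartAt 𝓘(ℝ, E) p ∘ fun q : ℝ × ℝ × ℝ => Ψ q.1 q.2.1 q.2.2) (box ρ)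
          (ι q) (0, 0, 1)) := fun q hq hp => by
    rw [inner_eq_chartMetric hp, comp_dt h.smooth hq.1 hq.2 ht hp hρ]
  refine ((hm.clm_apply hu).clm_apply hu).congr_of_eventuallyEq ?_ (heq q hq hp)
  filter_upwards [hΨ.continuousWithinAt (chart_source_mem_nhds E p), self_mem_nhdsWithin]
    with q' h1 h2
  exact heq q' h2 h1

theorem contDiffOn_dist (h : IsGeodesicVariation E γ η ρ Ψ) (hρ : 0 < ρ)
    (hpos : ∀ r ∈ Icc (0 : ℝ) 1, ∀ s ∈ Icc (0 : ℝ) 1, 0 < dist (γ s) (η r)) :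
    ContDiffOn ℝ ∞ (fun q : ℝ × ℝ => dist (γ q.2) (η q.1)) (Icc 0 1 ×ˢ Icc 0 1) := by
  have h0 : (0 : ℝ) ∈ Icc 0 ρ := ⟨le_rfl, hρ.le⟩
  refine (contDiffOn_const.mul ((h.contDiffOn_inner_dt hρ h0).sqrt fun q hq => ?_)).congr
    fun q hq => h.dist_eq_sqrt_inner hρ hq.1 hq.2 h0
  rw [h.inner_dt_self hq.1 hq.2 h0]
  have := hpos q.1 hq.1 q.2 hq.2
  positivity

/-- The first variation formula. -/
theorem hasDerivWithinAt_dist (h : IsGeodesicVariation E γ η ρ Ψ) (hρ : 0 < ρ)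
    (hr : r ∈ Icc (0 : ℝ) 1) (hs : s ∈ Icc (0 : ℝ) 1) (hpos : 0 < dist (γ s) (η r)) :
    HasDerivWithinAt (fun r' => dist (γ s) (η r'))
      (-(inner ℝ (dr E Ψ r s 0) (dt E ρ Ψ r s 0)) /
        √(inner ℝ (dt E ρ Ψ r s 0) (dt E ρ Ψ r s 0))) (Icc 0 1) r := by
  have h0 : (0 : ℝ) ∈ Icc 0 ρ := ⟨le_rfl, hρ.le⟩
  have h1 : ρ ∈ Icc 0 ρ := ⟨hρ.le, le_rfl⟩
  have hk := fun t (ht : t ∈ Icc 0 ρ) => exists_hasDerivWithinAt_inner_dr_dt hρ h.smooth hr hs ht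
    (h.geodesic r hr s hs)
  choose! k hk₁ hk₂ using hk
  have hk₂' : ∀ t ∈ Icc 0 ρ,
      HasDerivWithinAt (fun r' => (dist (γ s) (η r') / ρ) ^ 2) (2 * k t) (Icc 0 1) r := fun t ht =>
    (hk₂ t ht).congr (fun r' hr' => (h.inner_dt_self hr' hs ht).symm)
      (h.inner_dt_self hr hs ht).symm
  -- The speed does not depend on t, so each `2 * k t` is the derivative of the same function of r.
  have hkeq : ∀ t ∈ Icc 0 ρ, k t = k 0 := fun t ht =>
    mul_left_cancel₀ two_ne_zero
      ((uniqueDiffOn_Icc one_pos r hr).eq_deriv _ (hk₂' t ht) (hk₂' 0 h0))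
  have hend : dr E Ψ r s ρ = 0 :=
    velocity_of_eqOn_const (fun r' hr' => h.target r' hr' s hs) hr
  have hd : ∀ t ∈ Icc 0 ρ, HasDerivWithinAt
      (fun t => (inner ℝ (dr E Ψ r s t) (dt E ρ Ψ r s t) : ℝ) - k 0 * t) 0 (Icc 0 ρ) t :=
    fun t ht => ((hk₁ t ht).sub ((hasDerivWithinAt_id t _).const_mul (k 0))).congr_deriv
      (by rw [hkeq t ht]; simp)
  -- Comparing t = 0 with t = ρ, where ∂_rΨ vanishes, gives ⟨∂_rΨ, ∂_tΨ⟩ = -ρ * k 0 at t = 0.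
  have hconst := constant_of_derivWithin_zero (fun t ht => (hd t ht).differentiableWithinAt)
    (fun t ht => (hd t (Ico_subset_Icc_self ht)).derivWithin
      (uniqueDiffOn_Icc hρ t (Ico_subset_Icc_self ht))) ρ h1
  simp only [hend, inner_zero_left, mul_zero, sub_zero] at hconst
  rw [← hconst, h.inner_dt_self hr hs h0, Real.sqrt_sq (by positivity)]
  have hsq := ((hk₂' 0 h0).sqrt (by positivity)).const_mul ρ
  refine (hsq.congr_deriv ?_).congr (fun r' _ => ?_) ?_
  · rw [Real.sqrt_sq (by positivity)]
    field_simp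
    ring
  all_goals
    rw [Real.sqrt_sq (by positivity), mul_div_cancel₀ _ hρ.ne']

/-- The base curve s ↦ Ψ(r,s,0) is constant, so its velocity vanishes and kills the Christoffel
term. -/
theorem comp_Ds (h : IsGeodesicVariation E γ η ρ Ψ) (hr : r ∈ Icc (0 : ℝ) 1)
    (hs : s ∈ Icc (0 : ℝ) 1) (X : ∀ r s t, TangentSpace 𝓘(ℝ, E) (Ψ r s t)) :
    comp (η r) (Ds Ψ X r s 0) = derivWithin (fun s => comp (η r) (X r s 0)) (Icc 0 1) s :=
  comp_covDerivAlong_of_const (fun s => X r s 0) (h.source r hr) hs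

/-- `D_t ∂_s Ψ = D_s ∂_t Ψ` at the common source of the geodesics. -/
theorem comp_Dt_ds (h : IsGeodesicVariation E γ η ρ Ψ) (hρ : 0 < ρ)
    (hr : r ∈ Icc (0 : ℝ) 1) (hs : s ∈ Icc (0 : ℝ) 1) :
    comp (η r) (Dt ρ Ψ (ds E Ψ) r s 0) =
      derivWithin (fun s => comp (η r) (dt E ρ Ψ r s 0)) (Icc 0 1) s := by
  have h0 : (0 : ℝ) ∈ Icc 0 ρ := ⟨le_rfl, hρ.le⟩
  rw [← h.source r hr s hs]
  have hp : Ψ r s 0 ∈ (chartAt E (Ψ r s 0)).source := mem_chart_source E _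
  -- The field W vanishes at the fixed source, so `Dt` has no Christoffel term at t = 0 either; what
  -- remains is the symmetry of the chart Hessian.
  have hz : ds E Ψ r s 0 = 0 := velocity_of_eqOn_const (h.source r hr) hs
  refine (comp_covDerivAlong_of_eq_zero (J := Icc 0 ρ) (ds E Ψ r s) hz).trans ?_
  rw [(hasDerivWithinAt_comp_ds_t h.smooth hr hs h0 hp hρ).derivWithin (uniqueDiffOn_Icc hρ 0 h0),
    (hasDerivWithinAt_comp_dt_s h.smooth hr hs h0 hp hρ).derivWithin (uniqueDiffOn_Icc one_pos s hs)]
  exact chartHessian_symm hρ h.smooth (q := (r, s, 0)) ⟨hr, hs, h0⟩ hp _ _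

end IsGeodesicVariation

end Variation

end GeodVar

/-! ### The second and third variation formulas -/

theorem theoremT {E : Type*} [NormedAddCommGroup E] [NormedSpace ℝ E] [FiniteDimensional ℝ E]
    {M : Type*} [MetricSpace M] [ChartedSpace E M] [IsManifold 𝓘(ℝ, E) ∞ M]
    [RiemannianBundle (fun x : M => TangentSpace 𝓘(ℝ, E) x)]
    [IsContMDiffRiemannianBundle 𝓘(ℝ, E) ∞ E (fun x : M => TangentSpace 𝓘(ℝ, E) x)]
    [IsRiemannianManifold 𝓘(ℝ, E) M]
    (γ η : ℝ → M)
    (hγ : GeodVar.IsUnitSpeedGeodesic E γ) (hη : GeodVar.IsUnitSpeedGeodesic E η)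
    (hdisj : Disjoint (γ '' Icc 0 1) (η '' Icc 0 1))
    (φ : ℝ → ℝ → ℝ) (hφ : φ = fun r s => dist (γ s) (η r))
    (r₀ s₀ : ℝ) (hr₀ : r₀ ∈ Icc (0 : ℝ) 1) (hs₀ : s₀ ∈ Icc (0 : ℝ) 1)
    (ρ₀ : ℝ) (hρ₀ : ρ₀ = φ r₀ s₀)
    (Ψ : ℝ → ℝ → ℝ → M) (hΨ : GeodVar.IsGeodesicVariation E γ η ρ₀ Ψ)
    -- the following vectors are all tangent to `M` at `Ψ r₀ s₀ 0 = η r₀`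
    (σ' V₀ DtW₀ DssdtΨ : TangentSpace 𝓘(ℝ, E) (Ψ r₀ s₀ 0))
    (hσ' : σ' = GeodVar.dt E ρ₀ Ψ r₀ s₀ 0)
    (hV₀ : V₀ = GeodVar.dr E Ψ r₀ s₀ 0)
    (hDtW₀ : DtW₀ = GeodVar.Dt ρ₀ Ψ (GeodVar.ds E Ψ) r₀ s₀ 0)
    (hDssdtΨ : DssdtΨ = GeodVar.Ds Ψ (GeodVar.Ds Ψ (GeodVar.dt E ρ₀ Ψ)) r₀ s₀ 0) :
    ContDiffOn ℝ ∞ (fun q : ℝ × ℝ => φ q.1 q.2) (Icc 0 1 ×ˢ Icc 0 1) ∧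
    GeodVar.partialS (GeodVar.partialR φ) r₀ s₀
      = - inner ℝ (GeodVar.perp σ' V₀) (GeodVar.perp σ' DtW₀) ∧
    GeodVar.partialS (GeodVar.partialS (GeodVar.partialR φ)) r₀ s₀
      = - inner ℝ (GeodVar.perp σ' V₀) (GeodVar.perp σ' DssdtΨ)
        + 2 * inner ℝ (GeodVar.perp σ' DtW₀) (GeodVar.perp σ' V₀) * inner ℝ DtW₀ σ'
        + ‖GeodVar.perp σ' DtW₀‖ ^ 2 * inner ℝ V₀ σ' := by
  have hpos : ∀ r ∈ Icc (0 : ℝ) 1, ∀ s ∈ Icc (0 : ℝ) 1, 0 < dist (γ s) (η r) :=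
    fun r hr s hs => dist_pos.2 (hdisj.ne_of_mem (mem_image_of_mem γ hs) (mem_image_of_mem η hr))
  obtain rfl := hφ
  change ρ₀ = dist (γ s₀) (η r₀) at hρ₀
  have hρ : 0 < ρ₀ := hρ₀ ▸ hpos r₀ hr₀ s₀ hs₀
  have h0 : (0 : ℝ) ∈ Icc 0 ρ₀ := ⟨le_rfl, hρ.le⟩
  refine ⟨hΨ.contDiffOn_dist hρ hpos, ?_⟩
  have hsrc : ∀ s ∈ Icc (0 : ℝ) 1, Ψ r₀ s 0 ∈ (chartAt E (η r₀)).source := fun s hs => by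
    rw [hΨ.source r₀ hr₀ s hs]
    exact mem_chart_source E _
  -- The scalar products at `Ψ r₀ s 0`, for all s, are one bilinear form on `E`, so they can be
  -- differentiated in s with constant coefficients.
  have hinner : ∀ s ∈ Icc (0 : ℝ) 1, ∀ X Y : TangentSpace 𝓘(ℝ, E) (Ψ r₀ s 0),
      (inner ℝ X Y : ℝ) = GeodVar.chartMetric (E := E) (η r₀) (η r₀) (GeodVar.comp (η r₀) X)
        (GeodVar.comp (η r₀) Y) := fun s hs X Y => by
    rw [GeodVar.inner_eq_chartMetric (hsrc s hs), hΨ.source r₀ hr₀ s hs]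
  have hunit : (inner ℝ σ' σ' : ℝ) = 1 := by
    rw [hσ', hΨ.inner_dt_self hr₀ hs₀ h0, ← hρ₀, div_self hρ.ne', one_pow]
  have hT := hΨ.contDiffOn_comp_dt hρ hr₀
  have hT₁ := hT.derivWithin (m := ∞) (uniqueDiffOn_Icc one_pos) (by simp)
  have hDss : GeodVar.comp (η r₀) DssdtΨ = derivWithin (derivWithin
      (fun s => GeodVar.comp (η r₀) (GeodVar.dt E ρ₀ Ψ r₀ s 0)) (Icc 0 1)) (Icc 0 1) s₀ := by
    rw [hDssdtΨ, hΨ.comp_Ds hr₀ hs₀]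
    exact derivWithin_congr (fun s hs => hΨ.comp_Ds hr₀ hs _) (hΨ.comp_Ds hr₀ hs₀ _)
  have hDt := hΨ.comp_Dt_ds hρ hr₀ hs₀
  rw [← hDtW₀] at hDt
  have key := GeodVar.derivWithin_neg_bilin_div_sqrt
    (G := GeodVar.chartMetric (E := E) (η r₀) (η r₀))
    (GeodVar.chartMetric_symm (mem_chart_source E _)) (uniqueDiffOn_Icc one_pos) hs₀
    (T := fun s => GeodVar.comp (η r₀) (GeodVar.dt E ρ₀ Ψ r₀ s 0)) (v := GeodVar.comp (η r₀) V₀)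
    (fun s hs => ((hT s hs).differentiableWithinAt (by simp)).hasDerivWithinAt)
    ((hT₁ s₀ hs₀).differentiableWithinAt (by simp)).hasDerivWithinAt
    (fun s hs => by
      rw [← hinner s hs, hΨ.inner_dt_self hr₀ hs h0]
      have := hpos r₀ hr₀ s hs
      positivity)
    (by rw [← hinner s₀ hs₀, ← hσ', hunit])
    -- As a function of s, this is ∂_rφ(r₀,s); its first two derivatives within [0,1] are the two
    -- quantities sought.
    (f := GeodVar.partialR (fun r s => dist (γ s) (η r)) r₀)
    (fun s hs => by
      rw [GeodVar.partialR, (hΨ.hasDerivWithinAt_dist hρ hr₀ hs (hpos r₀ hr₀ s hs)).derivWithin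
        (uniqueDiffOn_Icc one_pos r₀ hr₀), hinner s hs, hinner s hs, hV₀,
        hΨ.comp_dr_source hr₀ hs hs₀])
  rw [← hDss, ← hDt, ← hσ', ← hinner s₀ hs₀, ← hinner s₀ hs₀, ← hinner s₀ hs₀, ← hinner s₀ hs₀,
    ← hinner s₀ hs₀, ← hinner s₀ hs₀] at key
  constructor
  -- As |σ'| = 1, ⟨X^⊥, Y^⊥⟩ = ⟨X,Y⟩ - ⟨X,σ'⟩⟨Y,σ'⟩; both formulas are then polynomial identities in
  -- scalar products.
  · refine key.1.trans ?_
    rw [GeodVar.inner_perp_perp hunit, real_inner_comm DtW₀ σ']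
    ring
  · refine key.2.trans ?_
    rw [GeodVar.inner_perp_perp hunit, GeodVar.inner_perp_perp hunit, ← real_inner_self_eq_norm_sq,
      GeodVar.inner_perp_perp hunit, real_inner_comm DtW₀ σ', real_inner_comm DssdtΨ σ',
      real_inner_comm V₀ DtW₀]
    ring
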